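/- Scalars are real or complex. A subset $A$ of a Banach space $X$ is a Banach–Saks set if every sequence in $A$ has a subsequence $(y_n)_n$ whose averages $\frac1n\sum_{k=1}^n y_k$ converge in norm in $X$; a sequence is called Banach–Saks if its set of terms is. A family is a set $\mathcal F$ of finite subsets of $\mathbb N$. It is compact if it is compact as a subset of $2^{\mathbb N}$ with the product topology, pre-compact if its closure in $2^{\mathbb N}$ consists only of finite sets, and hereditary if $s\subseteq t\in\mathcal F$ implies $s\in\mathcal F$. It is large in an infinite set $M\subseteq\mathbb N$ if for every infinite $K\subseteq M$ and every $n\in\mathbb N$ there is $s\in\mathcal F$ with $\#(s\cap K)\ge n$. For a pre-compact family $\mathcal F$, the Schreier-like space $X_{\mathcal F}$ is the completion of $c_{00}(\mathbb N)$ under the norm $$\|x\|_{\mathcal F}=\max\Big\{\|x\|_\infty,\ \sup_{s\in\mathcal F}\sum_{n\in s}|(x)_n|\Big\},$$ and $(u_n)_n$ denotes its unit vector basis. Theorem. The following are equivalent. (a) There are a Banach space $X$ and a weakly null sequence $(x_n)_n$ in $X$ with $\|x_n\|=1$ for all $n$ such that $\{x_n\}_n$ is a Banach–Saks set but its convex hull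 is not. (b) There is a pre-compact family $\mathcal F$ such that, in $X_{\mathcal F}$, the set $\{u_n\}_n$ is Banach–Saks but its convex hull is not. (c) There is a compact and hereditary family $\mathcal F$ such that (c.1) $\mathcal F$ is not large in any infinite $M\subseteq\mathbb N$; and (c.2) there are a partition $\bigcup_n I_n=\mathbb N$ into finite sets $I_n$, a probability measure $\mu_n$ on $I_n$ for each $n$, and $\delta>0$ such that the family $$\mathcal G_\delta^{\bar\mu}(\mathcal F)=\Big\{t\subseteq\mathbb N \text{ finite}:\ \text{there is } s\in\mathcal F \text{ with } \mu_n(s\cap I_n)\ge\delta \text{ for all } n\in t\Big\}$$ is large in $\mathbb N$. -/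

import Mathlib

universe u

/-- A subset `A` of a normed space is a Banach-Saks set when every sequence in `A` has a
Cesàro-convergent subsequence. -/
def IsBanachSaks {X : Type*} [NormedAddCommGroup X] [NormedSpace ℝ X] (A : Set X) : Prop :=
  ∀ x : ℕ → X, (∀ n, x n ∈ A) → ∃ φ : ℕ → ℕ, StrictMono φ ∧ ∃ y : X,
    Filter.Tendsto (fun n : ℕ => (n : ℝ)⁻¹ • ∑ k ∈ Finset.range n, x (φ k)) Filter.atTop (nhds y)

/-- A sequence is weakly null when every continuous linear functional sends it to a null sequence. -/
def IsWeaklyNull (𝕜 : Type*) [RCLike 𝕜] {X : Type*} [NormedAddCommGroup X] [NormedSpace 𝕜 X]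
    (x : ℕ → X) : Prop :=
  ∀ f : StrongDual 𝕜 X, Filter.Tendsto (fun n => f (x n)) Filter.atTop (nhds 0)

/-! ### Families of finite subsets of `ℕ` -/

/-- The family `F`, seen as a subset of the Cantor space `2^ℕ` through characteristic functions. -/
def familyInCantor (F : Set (Finset ℕ)) : Set (ℕ → Bool) :=
  (fun (s : Finset ℕ) (n : ℕ) => decide (n ∈ s)) '' F

/-- `F` is compact in the topology induced by the product topology on `2^ℕ`. -/
def IsCompactFamily (F : Set (Finset ℕ)) : Prop :=
  IsCompact (familyInCantor F)

/-- `F` is pre-compact: its closure in `2^ℕ` consists only of finite sets. -/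
def IsPrecompactFamily (F : Set (Finset ℕ)) : Prop :=
  ∀ f ∈ closure (familyInCantor F), {n : ℕ | f n = true}.Finite

/-- `F` is closed under taking subsets. -/
def IsHereditaryFamily (F : Set (Finset ℕ)) : Prop :=
  ∀ t ∈ F, ∀ s : Finset ℕ, s ⊆ t → s ∈ F

/-- `F` is `n`-large in `J`: every infinite `K ⊆ J` meets some member of `F` in at least `n`
points. -/
def IsNLargeIn (F : Set (Finset ℕ)) (n : ℕ) (J : Set ℕ) : Prop :=
  ∀ K : Set ℕ, K ⊆ J → K.Infinite → ∃ s ∈ F, n ≤ ((s : Set ℕ) ∩ K).ncard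

/-- `F` is large in `J`: it is `n`-large in `J` for every `n`. -/
def IsLargeIn (F : Set (Finset ℕ)) (J : Set ℕ) : Prop :=
  ∀ n : ℕ, IsNLargeIn F n J

/-- The family of all finite `t ⊆ ℕ` for which some `s ∈ F` satisfies `μ n (s ∩ I n) ≥ δ` for all
`n ∈ t`. -/
def familyG (F : Set (Finset ℕ)) (I : ℕ → Finset ℕ)
    (μ : ∀ n, MeasureTheory.ProbabilityMeasure (I n)) (δ : ℝ) : Set (Finset ℕ) :=
  {t | ∃ s ∈ F, ∀ n ∈ t, δ ≤ (μ n {i : I n | (i : ℕ) ∈ s} : ℝ)}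

/-! ### Schreier-like spaces -/

/-- The Schreier-like norm `max (‖x‖_∞) (sup_{s ∈ F} ∑_{n ∈ s} |x_n|)` on `c₀₀`. -/
noncomputable def schreierNorm {𝕜 : Type*} [RCLike 𝕜] (F : Set (Finset ℕ)) (x : ℕ →₀ 𝕜) : ℝ :=
  max (⨆ n, ‖x n‖) (⨆ s : F, ∑ n ∈ s.1, ‖x n‖)

section norm

variable {𝕜 : Type*} [RCLike 𝕜] (F : Set (Finset ℕ))

theorem sum_norm_le_support (x : ℕ →₀ 𝕜) (s : Finset ℕ) :
    ∑ n ∈ s, ‖x n‖ ≤ ∑ n ∈ x.support, ‖x n‖ := by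
  classical
  rw [← Finset.sum_filter_add_sum_filter_not s (fun n => n ∈ x.support)]
  have h0 : ∑ n ∈ s with n ∉ x.support, ‖x n‖ = 0 := by
    refine Finset.sum_eq_zero fun n hn => ?_
    simpa using (Finset.mem_filter.1 hn).2
  rw [h0, add_zero]
  exact Finset.sum_le_sum_of_subset_of_nonneg (fun n hn => (Finset.mem_filter.1 hn).2)
    (fun _ _ _ => norm_nonneg _)

theorem schreier_bddAbove_sup (x : ℕ →₀ 𝕜) : BddAbove (Set.range fun n => ‖x n‖) := by
  refine ⟨∑ n ∈ x.support, ‖x n‖, ?_⟩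
  rintro _ ⟨n, rfl⟩
  simpa using sum_norm_le_support x {n}

theorem schreier_bddAbove_sum (x : ℕ →₀ 𝕜) :
    BddAbove (Set.range fun s : F => ∑ n ∈ s.1, ‖x n‖) := by
  refine ⟨∑ n ∈ x.support, ‖x n‖, ?_⟩
  rintro _ ⟨s, rfl⟩
  exact sum_norm_le_support x s.1

theorem norm_le_schreierNorm (x : ℕ →₀ 𝕜) (n : ℕ) : ‖x n‖ ≤ schreierNorm F x :=
  (le_ciSup (schreier_bddAbove_sup x) n).trans (le_max_left _ _)

theorem sum_le_schreierNorm (x : ℕ →₀ 𝕜) {s : Finset ℕ} (hs : s ∈ F) :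
    ∑ n ∈ s, ‖x n‖ ≤ schreierNorm F x :=
  (le_ciSup (schreier_bddAbove_sum F x) ⟨s, hs⟩).trans (le_max_right _ _)

theorem schreierNorm_nonneg (x : ℕ →₀ 𝕜) : 0 ≤ schreierNorm F x :=
  (norm_nonneg _).trans (norm_le_schreierNorm F x 0)

theorem schreierNorm_le {x : ℕ →₀ 𝕜} {C : ℝ} (h1 : ∀ n, ‖x n‖ ≤ C)
    (h2 : ∀ s ∈ F, ∑ n ∈ s, ‖x n‖ ≤ C) : schreierNorm F x ≤ C :=
  max_le (ciSup_le h1)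
    (Real.iSup_le (fun s => h2 s.1 s.2) ((norm_nonneg _).trans (h1 0)))

theorem schreierNorm_smul_le {R : Type*} [NormedField R] [NormedSpace R 𝕜] (r : R)
    (x : ℕ →₀ 𝕜) : schreierNorm F (r • x) ≤ ‖r‖ * schreierNorm F x := by
  refine schreierNorm_le F (fun n => ?_) (fun s hs => ?_)
  · rw [Finsupp.smul_apply, norm_smul]
    exact mul_le_mul_of_nonneg_left (norm_le_schreierNorm F x n) (norm_nonneg _)
  · simp only [Finsupp.smul_apply, norm_smul, ← Finset.mul_sum]
    exact mul_le_mul_of_nonneg_left (sum_le_schreierNorm F x hs) (norm_nonneg _)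

end norm

/-- The space `c₀₀` of finitely supported scalar sequences, endowed with the Schreier-like norm
of `F`. -/
def SchreierC00 (𝕜 : Type*) [RCLike 𝕜] (_F : Set (Finset ℕ)) : Type _ := ℕ →₀ 𝕜

section space

variable (𝕜 : Type*) [RCLike 𝕜] (F : Set (Finset ℕ))

noncomputable instance : AddCommGroup (SchreierC00 𝕜 F) :=
  inferInstanceAs (AddCommGroup (ℕ →₀ 𝕜))

noncomputable instance {R : Type*} [NormedField R] [NormedSpace R 𝕜] :
    Module R (SchreierC00 𝕜 F) :=
  inferInstanceAs (Module R (ℕ →₀ 𝕜))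

/-- The Schreier-like norm as a group norm. -/
noncomputable def schreierAddGroupNorm : AddGroupNorm (SchreierC00 𝕜 F) where
  toFun x := schreierNorm (𝕜 := 𝕜) F x
  map_zero' := by
    refine le_antisymm (schreierNorm_le F (fun n => ?_) (fun s _ => ?_)) (schreierNorm_nonneg F _)
    · exact norm_zero.le
    · exact (Finset.sum_eq_zero fun n _ => norm_zero).le
  add_le' x y := by
    refine schreierNorm_le F (fun n => ?_) (fun s hs => ?_)
    · exact (norm_add_le _ _).trans
        (add_le_add (norm_le_schreierNorm (𝕜 := 𝕜) F x n) (norm_le_schreierNorm (𝕜 := 𝕜) F y n))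
    · refine (Finset.sum_le_sum fun n _ => norm_add_le _ _).trans ?_
      rw [Finset.sum_add_distrib]
      exact add_le_add (sum_le_schreierNorm (𝕜 := 𝕜) F x hs) (sum_le_schreierNorm (𝕜 := 𝕜) F y hs)
  neg' x := by
    have h (y : ℕ →₀ 𝕜) : schreierNorm F (-y) = schreierNorm F y := by
      simp only [schreierNorm, Finsupp.neg_apply, norm_neg]
    exact h x
  eq_zero_of_map_eq_zero' x hx := by
    refine Finsupp.ext (M := 𝕜) fun n => ?_
    have h := norm_le_schreierNorm (𝕜 := 𝕜) F x n
    exact norm_le_zero_iff.1 (h.trans_eq hx)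

noncomputable instance : NormedAddCommGroup (SchreierC00 𝕜 F) :=
  (schreierAddGroupNorm 𝕜 F).toNormedAddCommGroup

noncomputable instance {R : Type*} [NormedField R] [NormedSpace R 𝕜] :
    NormedSpace R (SchreierC00 𝕜 F) where
  norm_smul_le r x := schreierNorm_smul_le (𝕜 := 𝕜) F r x

/-- The Schreier-like space `X_F`: the completion of `c₀₀` under the Schreier-like norm. -/
abbrev SchreierSpace : Type _ := UniformSpace.Completion (SchreierC00 𝕜 F)

/-- The `n`-th vector `u_n` of the unit basis of `X_F`. -/
noncomputable def schreierUnit (n : ℕ) : SchreierSpace 𝕜 F :=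
  UniformSpace.Completion.coe' (show SchreierC00 𝕜 F from Finsupp.single n (1 : 𝕜))

end space

/-!
The equivalence rests on one quantitative notion: for a sequence `w` and `η > 0`, `bigSums w η` is
the family of finite `s` with `‖∑ i ∈ s, w i‖ ≥ η * #s`. A bounded sequence has a subsequence without
Cesàro-null subsequences exactly when, for some `η > 0` and some infinite `M`, every infinite subset
of `M` contains members of `bigSums w η` of every size. One implication
(`exists_bigSums_of_not_tendsto`) is a diagonal argument: otherwise some subsequence has small sums
over all blocks of some fixed length, for each degree of smallness. The other
(`exists_infinite_not_tendsto`) is Ramsey's theorem followed by a diagonal argument: along a suitable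
subsequence all sets lying far enough out are in `bigSums w η`, so the averages cannot vanish. The
Cesàro limits that occur are zero, for weakly null sequences by Hahn-Banach and in `X_F` for
coordinatewise null ones because the norm is a supremum of finite-coordinate seminorms.

From (c) to (b) the family is the same. Members of `F` meet a suitable subsequence of any given one
in boundedly many points, so sums of unit vectors over it stay bounded; and the convex combinations
of the unit vectors with weights `μ n` have all of `familyG F I μ δ` in their `bigSums`.

From (b) to (a) the sequence is the unit basis. It is weakly null because it is Banach-Saks and its
only possible Cesàro limits along subsequences tending to infinity are zero.

From (a) to (c) the family is `normingFamily 𝕜 x ε`: the finite sets on which some functional of the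
unit ball is at least `ε` along `x`. It is compact by the Banach-Alaoglu theorem, and large in no
infinite set, as its members contain proportional parts lying in `bigSums x (ε / 2)`. A sequence in
the convex hull without Cesàro-convergent subsequences is turned by a gliding hump into block sums
`w n` over successive intervals (`exists_blocks_of_not_isBanachSaks_convexHull`). A functional norming
a large sum of `w` is large on a proportion of the blocks, and on each of these it is large on
vectors of non-negligible total weight, which is the largeness of `familyG`.
-/

/-! ### Infinite subsets of `ℕ`: diagonalization and Ramsey's theorem -/

/-- Diagonalization: if a hereditary property `P a` can be achieved inside every infinite set, then
some infinite `K ⊆ M` has, for each of its elements `a`, the property `P a` beyond `a`. -/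
theorem Set.Infinite.exists_diagonal {P : ℕ → Set ℕ → Prop}
    (hmono : ∀ a A B, A ⊆ B → P a B → P a A) {M : Set ℕ} (hM : M.Infinite)
    (hex : ∀ a, ∀ A ⊆ M, A.Infinite → ∃ K ⊆ A, K.Infinite ∧ P a K) :
    ∃ K ⊆ M, K.Infinite ∧ ∀ a ∈ K, P a {b ∈ K | a < b} := by
  classical
  have hex' : ∀ A : {A : Set ℕ // A.Infinite ∧ A ⊆ M}, ∃ B : {A : Set ℕ // A.Infinite ∧ A ⊆ M},
      B.1 ⊆ {b ∈ A.1 | sInf A.1 < b} ∧ P (sInf A.1) B.1 := by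
    rintro ⟨A, hA, hAM⟩
    have hA' : {b ∈ A | sInf A < b}.Infinite := by
      refine (hA.sdiff (Set.finite_Iic (sInf A))).mono fun b hb => ⟨hb.1, ?_⟩
      simpa using hb.2
    obtain ⟨K, hKA, hK, hP⟩ := hex (sInf A) {b ∈ A | sInf A < b} (fun b hb => hAM hb.1) hA'
    exact ⟨⟨K, hK, fun b hb => hAM (hKA hb).1⟩, hKA, hP⟩
  choose nxt hnxt hP using hex'
  let A : ℕ → {A : Set ℕ // A.Infinite ∧ A ⊆ M} := fun i => nxt^[i] ⟨M, hM, subset_rfl⟩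
  have hsucc : ∀ i, A (i + 1) = nxt (A i) := fun i => Function.iterate_succ_apply' _ _ _
  let a : ℕ → ℕ := fun i => sInf (A i).1
  have hmem : ∀ i, a i ∈ (A i).1 := fun i => Nat.sInf_mem (A i).2.1.nonempty
  have hanti : Antitone fun i => (A i).1 := by
    refine antitone_nat_of_succ_le fun i => ?_
    rw [hsucc]
    exact (hnxt (A i)).trans fun b hb => hb.1
  have hmono_a : StrictMono a := by
    refine strictMono_nat_of_lt_succ fun i => ?_
    have h := hmem (i + 1)
    rw [hsucc] at h
    exact (hnxt (A i) h).2
  refine ⟨Set.range a, ?_, Set.infinite_range_of_injective hmono_a.injective, ?_⟩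
  · rintro _ ⟨i, rfl⟩
    exact hanti (Nat.zero_le i) (hmem i)
  · rintro _ ⟨i, rfl⟩
    refine hmono _ _ _ ?_ (hP (A i))
    rintro _ ⟨⟨j, rfl⟩, hj⟩
    rw [← hsucc]
    exact hanti (Nat.succ_le_of_lt (hmono_a.lt_iff_lt.1 hj)) (hmem j)

/-- Ramsey's theorem for two-colourings of the `n`-element subsets of an infinite set. -/
theorem Set.Infinite.exists_homogeneous (n : ℕ) (H : Set (Finset ℕ)) {M : Set ℕ}
    (hM : M.Infinite) : ∃ K ⊆ M, K.Infinite ∧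
      ((∀ s : Finset ℕ, ↑s ⊆ K → s.card = n → s ∈ H) ∨
        ∀ s : Finset ℕ, ↑s ⊆ K → s.card = n → s ∉ H) := by
  classical
  induction n generalizing H M with
  | zero =>
    refine ⟨M, subset_rfl, hM, ?_⟩
    by_cases h : ∅ ∈ H
    · exact Or.inl fun s _ hs => by rwa [Finset.card_eq_zero.1 hs]
    · exact Or.inr fun s _ hs => by rwa [Finset.card_eq_zero.1 hs]
  | succ n ih =>
    let Q : ℕ → Set ℕ → Prop := fun a K => ∀ s : Finset ℕ, ↑s ⊆ K → s.card = n → insert a s ∈ H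
    let R : ℕ → Set ℕ → Prop := fun a K => ∀ s : Finset ℕ, ↑s ⊆ K → s.card = n → insert a s ∉ H
    obtain ⟨K, hKM, hK, hP⟩ := Set.Infinite.exists_diagonal (P := fun a K => Q a K ∨ R a K)
      (fun a A B hAB h => h.imp (fun h s hs => h s (hs.trans hAB))
        (fun h s hs => h s (hs.trans hAB)))
      hM (fun a A _ hA => ih {s | insert a s ∈ H} hA)
    -- In a set all of whose points have the same colour, the colour of an `(n + 1)`-subset is
    -- that of its minimum.
    have key : ∀ K' ⊆ K, ∀ s : Finset ℕ, ↑s ⊆ K' → s.card = n + 1 → ∃ a ∈ K', ∃ t : Finset ℕ,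
        ↑t ⊆ {b ∈ K | a < b} ∧ t.card = n ∧ s = insert a t := by
      intro K' hK' s hs hcard
      have hne : s.Nonempty := Finset.card_pos.1 (by omega)
      refine ⟨s.min' hne, hs (s.min'_mem hne), s.erase (s.min' hne), fun b hb => ?_, ?_, ?_⟩
      · have hb' := Finset.mem_coe.1 hb
        exact ⟨hK' (hs (Finset.mem_of_mem_erase hb')), Finset.min'_lt_of_mem_erase_min' _ _ hb'⟩
      · rw [Finset.card_erase_of_mem (s.min'_mem hne), hcard, Nat.add_sub_cancel]
      · rw [Finset.insert_erase (s.min'_mem hne)]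
    have hsplit : K = {a ∈ K | Q a {b ∈ K | a < b}} ∪ {a ∈ K | R a {b ∈ K | a < b}} := by
      ext a
      constructor
      · intro ha
        exact (hP a ha).imp (fun h => ⟨ha, h⟩) (fun h => ⟨ha, h⟩)
      · rintro (h | h) <;> exact h.1
    rcases Set.infinite_union.1 (hsplit ▸ hK) with h | h
    · refine ⟨_, (fun a ha => hKM ha.1), h, Or.inl fun s hs hcard => ?_⟩
      obtain ⟨a, ha, t, ht, htc, rfl⟩ := key _ (fun a ha => ha.1) s hs hcard
      exact ha.2 t ht htc
    · refine ⟨_, (fun a ha => hKM ha.1), h, Or.inr fun s hs hcard => ?_⟩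
      obtain ⟨a, ha, t, ht, htc, rfl⟩ := key _ (fun a ha => ha.1) s hs hcard
      exact ha.2 t ht htc

/-- If every infinite subset of `M` contains members of `H` of every size, then in some infinite
`K ⊆ M` all finite sets lying far enough out, relative to their size, belong to `H`. -/
theorem exists_infinite_forall_card_le_mem {H : Set (Finset ℕ)} {M : Set ℕ} (hM : M.Infinite)
    (hH : ∀ n, ∀ K ⊆ M, K.Infinite → ∃ s ∈ H, ↑s ⊆ K ∧ s.card = n) :
    ∃ K ⊆ M, K.Infinite ∧ ∀ a ∈ K, ∀ s : Finset ℕ, (∀ b ∈ s, b ∈ K ∧ a < b) → s.card ≤ a →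
      s ∈ H := by
  have hex : ∀ n, ∀ A ⊆ M, A.Infinite →
      ∃ K ⊆ A, K.Infinite ∧ ∀ s : Finset ℕ, ↑s ⊆ K → s.card ≤ n → s ∈ H := by
    intro n
    induction n with
    | zero =>
      intro A hAM hA
      refine ⟨A, subset_rfl, hA, fun s _ hs => ?_⟩
      obtain ⟨t, ht, -, htc⟩ := hH 0 A hAM hA
      rwa [Finset.card_eq_zero.1 (Nat.le_zero.1 hs), ← Finset.card_eq_zero.1 htc]
    | succ n ih =>
      intro A hAM hA
      obtain ⟨B, hBA, hB, hBs⟩ := ih A hAM hA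
      obtain ⟨K, hKB, hK, h | h⟩ := hB.exists_homogeneous (n + 1) H
      · refine ⟨K, hKB.trans hBA, hK, fun s hs hc => ?_⟩
        rcases Nat.lt_or_ge n s.card with hlt | hge
        · exact h s hs (by omega)
        · exact hBs s (hs.trans hKB) hge
      · obtain ⟨t, ht, htK, htc⟩ := hH (n + 1) K ((hKB.trans hBA).trans hAM) hK
        exact absurd ht (h t htK htc)
  obtain ⟨K, hKM, hK, h⟩ := Set.Infinite.exists_diagonal
    (P := fun a K => ∀ s : Finset ℕ, ↑s ⊆ K → s.card ≤ a → s ∈ H)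
    (fun a A B hAB h s hs => h s (hs.trans hAB)) hM hex
  exact ⟨K, hKM, hK, fun a ha s hs => h a ha s hs⟩

/-! ### Cesàro-null subsequences and finite sums of maximal order -/

/-- The finite sets `s` over which the sum of `x` has norm at least `η * #s`. -/
def bigSums {X : Type*} [NormedAddCommGroup X] (x : ℕ → X) (η : ℝ) : Set (Finset ℕ) :=
  {s | η * s.card ≤ ‖∑ i ∈ s, x i‖}

/-- If all blocks of length `n` from the index `c` on have small sums, then so do all initial
segments, up to an additive constant. -/
theorem norm_sum_range_le_of_blocks {X : Type*} [NormedAddCommGroup X] {u : ℕ → X}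
    (hu : ∀ k, ‖u k‖ ≤ 1) {η : ℝ} (hη : 0 ≤ η) {c n : ℕ} (hn : 0 < n)
    (h : ∀ m, c ≤ m → ‖∑ k ∈ Finset.range n, u (m + k)‖ ≤ η * n) (N : ℕ) :
    ‖∑ k ∈ Finset.range N, u k‖ ≤ c + n + η * N := by
  induction N using Nat.strong_induction_on with
  | _ N ih =>
    rcases Nat.lt_or_ge N (c + n) with hN | hN
    · have h1 : ‖∑ k ∈ Finset.range N, u k‖ ≤ N := by
        simpa using norm_sum_le_of_le (Finset.range N) fun k _ => hu k
      have h2 : (N : ℝ) ≤ c + n := by exact_mod_cast hN.le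
      have : 0 ≤ η * N := by positivity
      linarith
    · obtain ⟨m, rfl⟩ : ∃ m, N = m + n := ⟨N - n, by omega⟩
      rw [Finset.sum_range_add]
      have h1 := ih m (by omega)
      have h2 := h m (by omega)
      have h3 := norm_add_le (∑ k ∈ Finset.range m, u k) (∑ k ∈ Finset.range n, u (m + k))
      push_cast
      linarith

/-- A bounded sequence without Cesàro-null subsequences has, for some `η > 0`, sums of norm at
least `η * n` over some `n` terms of any subsequence of a suitable subsequence. -/
theorem exists_bigSums_of_not_tendsto {X : Type*} [NormedAddCommGroup X] [NormedSpace ℝ X]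
    {w : ℕ → X} (hw : ∀ n, ‖w n‖ ≤ 1)
    (h : ∀ φ : ℕ → ℕ, StrictMono φ → ¬ Filter.Tendsto
      (fun n : ℕ => (n : ℝ)⁻¹ • ∑ k ∈ Finset.range n, w (φ k)) Filter.atTop (nhds 0)) :
    ∃ η > 0, ∃ M : Set ℕ, M.Infinite ∧
      ∀ n, ∀ K ⊆ M, K.Infinite → ∃ s ∈ bigSums w η, ↑s ⊆ K ∧ s.card = n := by
  classical
  by_contra! hcon
  let P : ℕ → Set ℕ → Prop := fun j K =>
    ∃ n, ∀ s : Finset ℕ, ↑s ⊆ K → s.card = n → s ∉ bigSums w (1 / (j + 1))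
  have hP : ∀ j A B, A ⊆ B → P j B → P j A := fun j A B hAB ⟨n, hn⟩ =>
    ⟨n, fun s hs => hn s (hs.trans hAB)⟩
  have hex : ∀ a, ∀ A ⊆ Set.univ, A.Infinite → ∃ K ⊆ A, K.Infinite ∧ ∀ j < a, P j K := by
    intro a
    induction a with
    | zero => exact fun A _ hA => ⟨A, subset_rfl, hA, by simp⟩
    | succ a ih =>
      intro A hAM hA
      obtain ⟨B, hBA, hB, hBP⟩ := ih A hAM hA
      obtain ⟨n, K, hKB, hK, hs⟩ := hcon (1 / (a + 1)) Nat.one_div_pos_of_nat B hB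
      refine ⟨K, hKB.trans hBA, hK, fun j hj => ?_⟩
      rcases Nat.lt_succ_iff_lt_or_eq.1 hj with hj | rfl
      · exact hP j _ _ hKB (hBP j hj)
      · exact ⟨n, fun s hsK hc hsb => hs s hsb hsK hc⟩
  obtain ⟨K, -, hK, hKP⟩ := Set.Infinite.exists_diagonal (P := fun a K => ∀ j < a, P j K)
    (fun a A B hAB h j hj => hP j A B hAB (h j hj)) Set.infinite_univ hex
  have : Infinite K := hK.to_subtype
  let φ := Nat.orderEmbeddingOfSet K
  have hφK : ∀ k, φ k ∈ K := fun k => by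
    have := Set.mem_range_self (f := φ) k
    rwa [Nat.orderEmbeddingOfSet_range] at this
  refine h φ φ.strictMono (Metric.tendsto_atTop.2 fun ε hε => ?_)
  obtain ⟨j, hj⟩ := exists_nat_one_div_lt (half_pos hε)
  obtain ⟨n, hn⟩ := hKP (φ (j + 1)) (hφK _) j (lt_of_lt_of_le j.lt_succ_self φ.strictMono.le_apply)
  have hn0 : 0 < n := by
    rcases Nat.eq_zero_or_pos n with rfl | h0
    · exact absurd (by simp [bigSums]) (hn ∅ (by simp) rfl)
    · exact h0
  have hη : (0 : ℝ) ≤ 1 / (j + 1) := Nat.one_div_pos_of_nat.le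
  -- The indices from `j + 2` on are sent beyond `φ (j + 1)`, where the sums over `n` terms are small.
  have hblock := norm_sum_range_le_of_blocks (u := fun k => w (φ k)) (fun k => hw _) hη
    (c := j + 2) hn0 fun m hm => by
      have hs := hn ((Finset.range n).map ⟨fun k => φ (m + k), fun a b hab => by
        simpa using hab⟩) (fun b hb => by
          obtain ⟨k, -, rfl⟩ := Finset.mem_map.1 (Finset.mem_coe.1 hb)
          exact ⟨hφK _, φ.strictMono (by omega)⟩) (by simp)
      simp only [bigSums, Set.mem_ofPred_eq, Finset.sum_map, Finset.card_map, Finset.card_range,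
        not_le] at hs
      exact hs.le
  obtain ⟨N, hN⟩ := exists_nat_gt (((j + 2 : ℕ) + n : ℝ) / (ε / 2))
  have hN0 : (0 : ℝ) < N := lt_of_le_of_lt (by positivity) hN
  refine ⟨N, fun m hm => ?_⟩
  have hm' : (N : ℝ) ≤ m := by exact_mod_cast hm
  have hm0 : (0 : ℝ) < m := hN0.trans_le hm'
  rw [dist_zero_right, norm_smul, norm_inv, Real.norm_natCast, inv_mul_lt_iff₀ hm0]
  have h1 := (div_lt_iff₀ (half_pos hε)).1 (hN.trans_le hm')
  have h2 := hblock m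
  have h3 : 1 / ((j : ℝ) + 1) * m ≤ ε / 2 * m := by gcongr
  linarith

/-- If all finite subsets of `K` far enough out, relative to their size, belong to `bigSums`, then
no subsequence indexed in `K` is Cesàro null: compare the averages of lengths `n + 1` and
`2 * n + 1`. -/
theorem not_tendsto_of_forall_mem_bigSums {X : Type*} [NormedAddCommGroup X] [NormedSpace ℝ X]
    {w : ℕ → X} {η : ℝ} (hη : 0 < η) {K : Set ℕ}
    (hK : ∀ a ∈ K, ∀ s : Finset ℕ, (∀ b ∈ s, b ∈ K ∧ a < b) → s.card ≤ a → s ∈ bigSums w η)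
    {φ : ℕ → ℕ} (hφ : StrictMono φ) (hφK : ∀ k, φ k ∈ K) :
    ¬ Filter.Tendsto (fun n : ℕ => (n : ℝ)⁻¹ • ∑ k ∈ Finset.range n, w (φ k))
      Filter.atTop (nhds 0) := by
  intro h
  obtain ⟨N, hN⟩ := Metric.tendsto_atTop.1 h (η / 5) (by positivity)
  have hS : ∀ n, N ≤ n → 0 < n → ‖∑ k ∈ Finset.range n, w (φ k)‖ < n * (η / 5) := by
    intro n hn hn0
    have := hN n hn
    rwa [dist_zero_right, norm_smul, norm_inv, Real.norm_natCast,
      inv_mul_lt_iff₀ (by exact_mod_cast hn0)] at this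
  let n := N + 1
  have h1 := hS (n + 1) (by omega) (by omega)
  have h2 := hS (n + 1 + n) (by omega) (by omega)
  have h3 := hK (φ n) (hφK n) ((Finset.range n).map ⟨fun k => φ (n + 1 + k), fun a b hab => by
      simpa using hφ.injective hab⟩) (fun b hb => by
        obtain ⟨k, -, rfl⟩ := Finset.mem_map.1 hb
        exact ⟨hφK _, hφ (by omega)⟩) (by simpa using hφ.le_apply)
  simp only [bigSums, Set.mem_ofPred_eq, Finset.sum_map, Finset.card_map, Finset.card_range] at h3
  replace h3 : η * n ≤ ‖∑ k ∈ Finset.range n, w (φ (n + 1 + k))‖ := h3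
  rw [Finset.sum_range_add] at h2
  have h4 := norm_sub_le (∑ k ∈ Finset.range (n + 1), w (φ k) +
    ∑ k ∈ Finset.range n, w (φ (n + 1 + k))) (∑ k ∈ Finset.range (n + 1), w (φ k))
  rw [add_sub_cancel_left] at h4
  have h5 : (1 : ℝ) ≤ n := by simp [n]
  push_cast at h1 h2
  nlinarith

/-- If every infinite subset of `M` contains members of `bigSums w η` of every size, then `w` has a
subsequence without Cesàro-null subsequences. -/
theorem exists_infinite_not_tendsto {X : Type*} [NormedAddCommGroup X] [NormedSpace ℝ X]
    {w : ℕ → X} {η : ℝ} (hη : 0 < η) {M : Set ℕ} (hM : M.Infinite)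
    (hH : ∀ n, ∀ K ⊆ M, K.Infinite → ∃ s ∈ bigSums w η, ↑s ⊆ K ∧ s.card = n) :
    ∃ φ : ℕ → ℕ, StrictMono φ ∧ ∀ ψ : ℕ → ℕ, StrictMono ψ → ¬ Filter.Tendsto
      (fun n : ℕ => (n : ℝ)⁻¹ • ∑ k ∈ Finset.range n, w (φ (ψ k))) Filter.atTop (nhds 0) := by
  classical
  obtain ⟨K, -, hK, hKH⟩ := exists_infinite_forall_card_le_mem hM hH
  have : Infinite K := hK.to_subtype
  refine ⟨Nat.orderEmbeddingOfSet K, (Nat.orderEmbeddingOfSet K).strictMono, fun ψ hψ =>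
    not_tendsto_of_forall_mem_bigSums hη hKH
      ((Nat.orderEmbeddingOfSet K).strictMono.comp hψ) fun k => ?_⟩
  have := Set.mem_range_self (f := Nat.orderEmbeddingOfSet K) (ψ k)
  rwa [Nat.orderEmbeddingOfSet_range] at this

/-! ### The unit basis of a Schreier-like space -/

theorem IsLargeIn.exists_subset_card_eq {F : Set (Finset ℕ)} {M : Set ℕ} (hF : IsLargeIn F M)
    (hher : IsHereditaryFamily F) (n : ℕ) {K : Set ℕ} (hKM : K ⊆ M) (hK : K.Infinite) :
    ∃ s ∈ F, ↑s ⊆ K ∧ s.card = n := by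
  classical
  obtain ⟨s, hs, hn⟩ := hF n K hKM hK
  have hsK : (s : Set ℕ) ∩ K = ((s.filter (· ∈ K) : Finset ℕ) : Set ℕ) := by
    ext i; simp
  rw [hsK, Set.ncard_coe_finset] at hn
  obtain ⟨t, hts, htn⟩ := Finset.exists_subset_card_eq hn
  exact ⟨t, hher s hs t (hts.trans (Finset.filter_subset _ _)),
    fun i hi => (Finset.mem_filter.1 (hts hi)).2, htn⟩

theorem isHereditaryFamily_familyG (F : Set (Finset ℕ)) (I : ℕ → Finset ℕ)
    (μ : ∀ n, MeasureTheory.ProbabilityMeasure (I n)) (δ : ℝ) :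
    IsHereditaryFamily (familyG F I μ δ) :=
  fun _ ⟨s, hs, h⟩ _ hst => ⟨s, hs, fun n hn => h n (hst hn)⟩

theorem IsCompactFamily.isPrecompactFamily {F : Set (Finset ℕ)} (hF : IsCompactFamily F) :
    IsPrecompactFamily F := by
  intro f hf
  rw [IsClosed.closure_eq (IsCompact.isClosed hF)] at hf
  obtain ⟨s, -, rfl⟩ := hf
  exact s.finite_toSet.subset fun n hn => by simpa using hn

section schreier

variable (𝕜 : Type*) [RCLike 𝕜] (F : Set (Finset ℕ))

/-- The `i`-th coordinate on `c₀₀`, as a real-linear map. -/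
noncomputable def schreierCoord (i : ℕ) : SchreierC00 𝕜 F →ₗ[ℝ] 𝕜 :=
  (Finsupp.lapply i : (ℕ →₀ 𝕜) →ₗ[ℝ] 𝕜)

/-- The unit basis of `c₀₀` before completion. -/
noncomputable def schreierE (i : ℕ) : SchreierC00 𝕜 F :=
  (Finsupp.single i 1 : ℕ →₀ 𝕜)

variable {𝕜 F}

theorem schreierCoord_schreierE (i j : ℕ) :
    schreierCoord 𝕜 F i (schreierE 𝕜 F j) = if j = i then 1 else 0 := by
  classical
  exact Finsupp.single_apply

theorem norm_schreierCoord_le (x : SchreierC00 𝕜 F) (i : ℕ) : ‖schreierCoord 𝕜 F i x‖ ≤ ‖x‖ :=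
  norm_le_schreierNorm (𝕜 := 𝕜) F x i

theorem sum_norm_schreierCoord_le (x : SchreierC00 𝕜 F) {s : Finset ℕ} (hs : s ∈ F) :
    ∑ i ∈ s, ‖schreierCoord 𝕜 F i x‖ ≤ ‖x‖ :=
  sum_le_schreierNorm (𝕜 := 𝕜) F x hs

theorem norm_le_of_schreierCoord {x : SchreierC00 𝕜 F} {C : ℝ}
    (h1 : ∀ i, ‖schreierCoord 𝕜 F i x‖ ≤ C)
    (h2 : ∀ s ∈ F, ∑ i ∈ s, ‖schreierCoord 𝕜 F i x‖ ≤ C) : ‖x‖ ≤ C :=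
  schreierNorm_le (𝕜 := 𝕜) F h1 h2

/-- A Cauchy sequence of `c₀₀` that tends to zero coordinatewise tends to zero in norm, because the
norm is a supremum of seminorms depending on finitely many coordinates. -/
theorem CauchySeq.tendsto_zero_of_schreierCoord {a : ℕ → SchreierC00 𝕜 F} (ha : CauchySeq a)
    (h : ∀ i, Filter.Tendsto (fun n => schreierCoord 𝕜 F i (a n)) Filter.atTop (nhds 0)) :
    Filter.Tendsto a Filter.atTop (nhds 0) := by
  have hsum : ∀ m (s : Finset ℕ),
      Filter.Tendsto (fun n => ∑ i ∈ s, ‖schreierCoord 𝕜 F i (a m - a n)‖) Filter.atTop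
        (nhds (∑ i ∈ s, ‖schreierCoord 𝕜 F i (a m)‖)) := by
    intro m s
    refine tendsto_finsetSum _ fun i _ => ?_
    simpa using (tendsto_const_nhds.sub (h i)).norm
  refine Metric.tendsto_atTop.2 fun ε hε => ?_
  obtain ⟨N, hN⟩ := Metric.cauchySeq_iff.1 ha (ε / 2) (half_pos hε)
  refine ⟨N, fun m hm => ?_⟩
  rw [dist_zero_right]
  have hclose : ∀ᶠ n in Filter.atTop, ‖a m - a n‖ ≤ ε / 2 := by
    filter_upwards [Filter.eventually_ge_atTop N] with n hn
    rw [← dist_eq_norm]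
    exact (hN m hm n hn).le
  refine lt_of_le_of_lt (norm_le_of_schreierCoord (fun i => ?_) fun s hs => ?_) (half_lt_self hε)
  · have := le_of_tendsto (hsum m {i}) (hclose.mono fun n hn => by
      simpa using (norm_schreierCoord_le _ i).trans hn)
    simpa using this
  · exact le_of_tendsto (hsum m s) (hclose.mono fun n hn =>
      (sum_norm_schreierCoord_le _ hs).trans hn)

/-- The embedding of `c₀₀` into its completion. -/
noncomputable def schreierEmb : SchreierC00 𝕜 F →ₗᵢ[ℝ] SchreierSpace 𝕜 F :=
  UniformSpace.Completion.toComplₗᵢ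

theorem schreierEmb_schreierE (i : ℕ) :
    schreierEmb (schreierE 𝕜 F i) = schreierUnit 𝕜 F i := rfl

/-- Cesàro limits in `X_F` of coordinatewise null sequences of `c₀₀` vanish. -/
theorem eq_zero_of_tendsto_cesaro_schreierEmb {v : ℕ → SchreierC00 𝕜 F}
    (hv : ∀ i, Filter.Tendsto (fun k => schreierCoord 𝕜 F i (v k)) Filter.atTop (nhds 0))
    {y : SchreierSpace 𝕜 F}
    (hy : Filter.Tendsto (fun n : ℕ => (n : ℝ)⁻¹ • ∑ k ∈ Finset.range n, schreierEmb (v k))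
      Filter.atTop (nhds y)) : y = 0 := by
  have heq : (fun n : ℕ => (n : ℝ)⁻¹ • ∑ k ∈ Finset.range n, schreierEmb (v k)) =
      fun n : ℕ => schreierEmb ((n : ℝ)⁻¹ • ∑ k ∈ Finset.range n, v k) := by
    funext n
    rw [map_smul, map_sum]
  rw [heq] at hy
  have hc : CauchySeq fun n : ℕ => (n : ℝ)⁻¹ • ∑ k ∈ Finset.range n, v k :=
    (schreierEmb (𝕜 := 𝕜) (F := F)).isometry.isUniformInducing.cauchy_map_iff.1 <| by
      rw [Filter.map_map]
      exact hy.cauchySeq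
  have h0 := hc.tendsto_zero_of_schreierCoord fun i => by
    simpa using (hv i).cesaro_smul
  have h1 := (schreierEmb.continuous.tendsto 0).comp h0
  rw [map_zero] at h1
  exact tendsto_nhds_unique hy h1

theorem tendsto_schreierCoord_schreierE (i : ℕ) :
    Filter.Tendsto (fun k => schreierCoord 𝕜 F i (schreierE 𝕜 F k)) Filter.atTop (nhds 0) := by
  refine tendsto_const_nhds.congr' ?_
  filter_upwards [Filter.eventually_gt_atTop i] with k hk
  rw [schreierCoord_schreierE, if_neg hk.ne']

theorem schreierCoord_sum_schreierE (T : Finset ℕ) (i : ℕ) :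
    schreierCoord 𝕜 F i (∑ j ∈ T, schreierE 𝕜 F j) = if i ∈ T then 1 else 0 := by
  rw [map_sum]
  simp_rw [schreierCoord_schreierE]
  exact Finset.sum_ite_eq' T i fun _ => (1 : 𝕜)

theorem norm_sum_schreierE_le (T : Finset ℕ) {n : ℕ}
    (h : ∀ s ∈ F, (s ∩ T).card ≤ n) : ‖∑ j ∈ T, schreierE 𝕜 F j‖ ≤ n + 1 := by
  refine norm_le_of_schreierCoord (fun i => ?_) fun s hs => ?_
  · rw [schreierCoord_sum_schreierE]
    split_ifs <;> simp; positivity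
  · have : ∀ i, ‖schreierCoord 𝕜 F i (∑ j ∈ T, schreierE 𝕜 F j)‖ = if i ∈ T then 1 else 0 := by
      intro i
      rw [schreierCoord_sum_schreierE]
      split_ifs <;> simp
    simp_rw [this]
    rw [Finset.sum_ite_mem, Finset.sum_const, nsmul_one]
    have := h s hs
    exact_mod_cast this.trans n.le_succ

theorem norm_schreierUnit (n : ℕ) : ‖schreierUnit 𝕜 F n‖ = 1 := by
  rw [← schreierEmb_schreierE, LinearIsometry.norm_map]
  have hcoord : ∀ i, ‖schreierCoord 𝕜 F i (schreierE 𝕜 F n)‖ = if n = i then 1 else 0 := by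
    intro i
    rw [schreierCoord_schreierE]
    split_ifs <;> simp
  refine le_antisymm (norm_le_of_schreierCoord (fun i => ?_) fun s _ => ?_) ?_
  · rw [hcoord]
    split_ifs <;> simp
  · simp_rw [hcoord]
    rw [Finset.sum_ite_eq]
    split_ifs <;> simp
  · simpa [hcoord] using norm_schreierCoord_le (schreierE 𝕜 F n) n

/-- If the unit basis of `X_F` is Banach-Saks, then it is weakly null: a subsequence on which a
functional is close to some `c ≠ 0` would have a Cesàro limit that is not zero. -/
theorem isWeaklyNull_schreierUnit (h : IsBanachSaks (Set.range (schreierUnit 𝕜 F))) :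
    IsWeaklyNull 𝕜 (schreierUnit 𝕜 F) := by
  intro f
  refine Filter.tendsto_of_subseq_tendsto fun ns hns => ?_
  obtain ⟨θ, -, hθ⟩ := Filter.strictMono_subseq_of_tendsto_atTop hns
  obtain ⟨c, -, ψ, hψ, hc⟩ := (isCompact_closedBall (0 : 𝕜) ‖f‖).tendsto_subseq
    (x := fun n => f (schreierUnit 𝕜 F (ns (θ n)))) fun n => by
      simpa [norm_schreierUnit] using f.le_opNorm (schreierUnit 𝕜 F (ns (θ n)))
  obtain ⟨χ, hχ, y, hy⟩ := h (fun n => schreierUnit 𝕜 F (ns (θ (ψ n)))) fun n => ⟨_, rfl⟩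
  have hmono : StrictMono fun n => ns (θ (ψ (χ n))) := hθ.comp (hψ.comp hχ)
  obtain rfl := eq_zero_of_tendsto_cesaro_schreierEmb
    (fun i => (tendsto_schreierCoord_schreierE i).comp hmono.tendsto_atTop) hy
  have h1 : Filter.Tendsto (fun n : ℕ => (n : ℝ)⁻¹ • ∑ k ∈ Finset.range n,
      f (schreierUnit 𝕜 F (ns (θ (ψ (χ k)))))) Filter.atTop (nhds 0) := by
    have := (f.continuous.tendsto 0).comp hy
    rw [map_zero] at this
    refine this.congr fun n => ?_
    simp only [Function.comp_apply]
    rw [ContinuousLinearMap.map_smul_of_tower, map_sum]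
  have h2 := (hc.comp hχ.tendsto_atTop).cesaro_smul
  obtain rfl := tendsto_nhds_unique h1 h2
  exact ⟨_, hc⟩

/-- If `F` is not large in any infinite set, then the unit basis of `X_F` is Banach-Saks. -/
theorem isBanachSaks_range_schreierUnit (hF : ∀ M : Set ℕ, M.Infinite → ¬ IsLargeIn F M) :
    IsBanachSaks (Set.range (schreierUnit 𝕜 F)) := by
  classical
  intro x hx
  choose g hg using hx
  by_cases hfin : ∃ c, (g ⁻¹' {c}).Infinite
  · obtain ⟨c, hc⟩ := hfin
    have : Infinite (g ⁻¹' {c}) := hc.to_subtype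
    refine ⟨Nat.orderEmbeddingOfSet (g ⁻¹' {c}), OrderEmbedding.strictMono _,
      schreierUnit 𝕜 F c, (tendsto_const_nhds.congr fun k => ?_).cesaro_smul⟩
    have hk := Set.mem_range_self (f := Nat.orderEmbeddingOfSet (g ⁻¹' {c})) k
    rw [Nat.orderEmbeddingOfSet_range] at hk
    rw [← hg]
    exact congrArg _ (Eq.symm hk)
  · have hg' : Filter.Tendsto g Filter.atTop Filter.atTop := by
      rw [← Nat.cofinite_eq_atTop]
      refine Filter.Tendsto.cofinite_of_finite_preimage_singleton fun c => ?_
      by_contra hc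
      exact hfin ⟨c, hc⟩
    obtain ⟨φ, hφ, hgφ⟩ := Filter.strictMono_subseq_of_tendsto_atTop hg'
    have hlarge := hF (Set.range (g ∘ φ)) (Set.infinite_range_of_injective hgφ.injective)
    simp only [IsLargeIn, IsNLargeIn, not_forall, not_exists, not_and, not_le] at hlarge
    obtain ⟨n, K, hKM, hK, hn⟩ := hlarge
    have hJ : ((g ∘ φ) ⁻¹' K).Infinite := hK.preimage hKM
    have : Infinite ((g ∘ φ) ⁻¹' K) := hJ.to_subtype
    let ψ := Nat.orderEmbeddingOfSet ((g ∘ φ) ⁻¹' K)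
    have hψK : ∀ k, g (φ (ψ k)) ∈ K := fun k => by
      have hk := Set.mem_range_self (f := ψ) k
      rwa [Nat.orderEmbeddingOfSet_range] at hk
    refine ⟨fun k => φ (ψ k), hφ.comp ψ.strictMono, 0, ?_⟩
    have hbound : ∀ N : ℕ, ‖∑ k ∈ Finset.range N, x (φ (ψ k))‖ ≤ n + 1 := by
      intro N
      have hinj : Function.Injective fun k => g (φ (ψ k)) :=
        hgφ.injective.comp ψ.strictMono.injective
      have hsum : ∑ k ∈ Finset.range N, x (φ (ψ k)) =
          schreierEmb (∑ j ∈ (Finset.range N).map ⟨_, hinj⟩, schreierE 𝕜 F j) := by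
        rw [Finset.sum_map, map_sum]
        exact Finset.sum_congr rfl fun k _ => (hg _).symm
      rw [hsum, LinearIsometry.norm_map]
      refine norm_sum_schreierE_le _ fun s hs => ?_
      rw [← Set.ncard_coe_finset]
      refine (Set.ncard_le_ncard ?_ (s.finite_toSet.inter_of_left K)).trans (hn s hs).le
      intro i hi
      obtain ⟨his, hi⟩ := Finset.mem_inter.1 (Finset.mem_coe.1 hi)
      obtain ⟨k, -, rfl⟩ := Finset.mem_map.1 hi
      exact ⟨his, hψK k⟩
    refine squeeze_zero_norm (a := fun N : ℕ => (N : ℝ)⁻¹ * (n + 1)) (fun N => ?_) ?_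
    · rw [norm_smul, norm_inv, Real.norm_natCast]
      exact mul_le_mul_of_nonneg_left (hbound N) (by positivity)
    · simpa using (tendsto_inv_atTop_nhds_zero_nat (𝕜 := ℝ)).mul_const ((n : ℝ) + 1)

end schreier

/-! ### Probability measures on finite sets of integers -/

theorem MeasureTheory.ProbabilityMeasure.exists_weights {I : Finset ℕ}
    (μ : MeasureTheory.ProbabilityMeasure I) : ∃ ν : ℕ → ℝ, (∀ i, 0 ≤ ν i) ∧ (∀ i ∉ I, ν i = 0) ∧
      ∀ s : Finset ℕ, (μ {i : I | (i : ℕ) ∈ s} : ℝ) = ∑ i ∈ s, ν i := by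
  classical
  refine ⟨fun i => if h : i ∈ I then (μ {⟨i, h⟩} : ℝ) else 0, fun i => ?_, fun i hi => dif_neg hi,
    fun s => ?_⟩
  · dsimp only
    split_ifs <;> simp
  · have hs : {i : I | (i : ℕ) ∈ s} = ((Finset.univ.filter fun i : I => (i : ℕ) ∈ s : Finset I) :
        Set I) := by ext; simp
    have h1 : (μ {i : I | (i : ℕ) ∈ s} : ℝ) =
        ∑ i ∈ Finset.univ.filter fun i : I => (i : ℕ) ∈ s, (μ {i} : ℝ) := by
      rw [hs]
      exact (MeasureTheory.sum_measureReal_singleton (μ := (μ : MeasureTheory.Measure I)) _).symm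
    rw [h1, Finset.sum_filter]
    have h2 : ∑ i : I, (if (i : ℕ) ∈ s then (μ {i} : ℝ) else 0) =
        ∑ i ∈ I.attach, (if (i : ℕ) ∈ s then
          (if h : (i : ℕ) ∈ I then (μ {⟨i, h⟩} : ℝ) else 0) else 0) := by
      refine Finset.sum_congr rfl fun i _ => ?_
      rw [dif_pos i.2]
    rw [h2, Finset.sum_attach I fun i => if i ∈ s then
      (if h : i ∈ I then (μ {⟨i, h⟩} : ℝ) else 0) else 0, ← Finset.sum_filter]
    refine Finset.sum_subset (fun i hi => (Finset.mem_filter.1 hi).2) fun i his hi => ?_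
    exact dif_neg fun h => hi (Finset.mem_filter.2 ⟨h, his⟩)

/-- Weights of total mass at most one on a non-empty finite set are dominated by a probability
measure: the missing mass is put on one point. -/
theorem exists_probabilityMeasure_of_weights {I : Finset ℕ} (hI : I.Nonempty) {ν : ℕ → ℝ}
    (hν : ∀ i, 0 ≤ ν i) (hν1 : ∑ i ∈ I, ν i ≤ 1) :
    ∃ μ : MeasureTheory.ProbabilityMeasure I,
      ∀ s ⊆ I, ∑ i ∈ s, ν i ≤ (μ {i : I | (i : ℕ) ∈ s} : ℝ) := by
  classical
  obtain ⟨i₀, hi₀⟩ := hI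
  let m : I → ℝ := fun i => ν i + if (i : ℕ) = i₀ then 1 - ∑ i ∈ I, ν i else 0
  have hm0 : ∀ i : I, ν i ≤ m i := fun i => by
    dsimp only [m]
    split_ifs <;> linarith
  have hm : ∑ i, ENNReal.ofReal (m i) = 1 := by
    rw [← ENNReal.ofReal_sum_of_nonneg fun (i : I) _ => (hν i).trans (hm0 i)]
    have : ∑ i, m i = 1 := by
      have h := Finset.sum_attach I fun i => ν i + if i = i₀ then 1 - ∑ i ∈ I, ν i else 0
      refine h.trans ?_
      rw [Finset.sum_add_distrib, Finset.sum_ite_eq' I i₀, if_pos hi₀]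
      ring
    rw [this, ENNReal.ofReal_one]
  let p : PMF I := PMF.ofFintype (fun i => ENNReal.ofReal (m i)) hm
  refine ⟨⟨p.toMeasure, inferInstance⟩, fun s hs => ?_⟩
  have hset : {i : I | (i : ℕ) ∈ s} = ((Finset.univ.filter fun i : I => (i : ℕ) ∈ s : Finset I) :
      Set I) := by ext; simp
  have hval : p.toMeasure {i : I | (i : ℕ) ∈ s} =
      ENNReal.ofReal (∑ i ∈ Finset.univ.filter fun i : I => (i : ℕ) ∈ s, m i) := by
    rw [hset, PMF.toMeasure_apply_finset,
      ENNReal.ofReal_sum_of_nonneg fun (i : I) _ => (hν i).trans (hm0 i)]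
    rfl
  change _ ≤ (p.toMeasure {i : I | (i : ℕ) ∈ s}).toReal
  rw [hval, ENNReal.toReal_ofReal (Finset.sum_nonneg fun (i : I) _ => (hν i).trans (hm0 i))]
  refine le_trans (le_of_eq ?_) (Finset.sum_le_sum fun (i : I) _ => hm0 i)
  rw [Finset.sum_filter]
  refine Eq.trans ?_ (Finset.sum_attach I fun i => if i ∈ s then ν i else 0).symm
  rw [Finset.sum_ite_mem, Finset.inter_eq_right.2 hs]

/-! ### The convex hull of the unit basis of a Schreier-like space -/

section schreier

variable {𝕜 : Type*} [RCLike 𝕜] {F : Set (Finset ℕ)}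

/-- The convex combinations of the unit vectors with weights `μ n` have sums of norm at least
`δ * #t` over each `t` in `familyG F I μ δ`, so they witness the failure of the Banach-Saks property
when this family is large. -/
theorem not_isBanachSaks_convexHull_range_schreierUnit {I : ℕ → Finset ℕ}
    {μ : ∀ n, MeasureTheory.ProbabilityMeasure (I n)} {δ : ℝ}
    (hI : ∀ m n, m ≠ n → Disjoint (I m) (I n)) (hδ : 0 < δ)
    (hG : IsLargeIn (familyG F I μ δ) Set.univ) :
    ¬ IsBanachSaks (convexHull ℝ (Set.range (schreierUnit 𝕜 F))) := by
  classical
  choose ν hν0 hνI hν using fun n => (μ n).exists_weights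
  have hν1 : ∀ n, ∑ i ∈ I n, ν n i = 1 := by
    intro n
    rw [← hν n (I n)]
    simp
  let v : ℕ → SchreierC00 𝕜 F := fun n => ∑ i ∈ I n, ν n i • schreierE 𝕜 F i
  have hcoord : ∀ n i, schreierCoord 𝕜 F i (v n) = (ν n i : 𝕜) := by
    intro n i
    simp only [v, map_sum, map_smul, schreierCoord_schreierE]
    by_cases hi : i ∈ I n
    · rw [Finset.sum_eq_single_of_mem i hi fun j _ hj => by rw [if_neg hj, smul_zero], if_pos rfl,
        ← RCLike.ofReal_alg]
    · rw [hνI n i hi, RCLike.ofReal_zero]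
      refine Finset.sum_eq_zero fun j hj => ?_
      rw [if_neg (by rintro rfl; exact hi hj), smul_zero]
  have hv0 : ∀ i, Filter.Tendsto (fun n => schreierCoord 𝕜 F i (v n)) Filter.atTop (nhds 0) := by
    intro i
    refine tendsto_const_nhds.congr' ?_
    by_cases h : ∃ m, i ∈ I m
    · obtain ⟨m, hm⟩ := h
      filter_upwards [Filter.eventually_gt_atTop m] with n hn
      rw [hcoord, hνI n i (Finset.disjoint_left.1 (hI m n hn.ne) hm), RCLike.ofReal_zero]
    · refine Filter.Eventually.of_forall fun n => ?_
      beta_reduce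
      rw [hcoord, hνI n i fun hn => h ⟨n, hn⟩, RCLike.ofReal_zero]
  have hbig : familyG F I μ δ ⊆ bigSums (fun n => schreierEmb (v n)) δ := by
    rintro t ⟨s, hs, hst⟩
    have h1 : ∀ i, ‖schreierCoord 𝕜 F i (∑ n ∈ t, v n)‖ = ∑ n ∈ t, ν n i := by
      intro i
      simp_rw [map_sum, hcoord]
      rw [← RCLike.ofReal_sum, RCLike.norm_ofReal,
        abs_of_nonneg (Finset.sum_nonneg fun n _ => hν0 n i)]
    have h2 := sum_norm_schreierCoord_le (∑ n ∈ t, v n) hs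
    simp_rw [h1] at h2
    rw [Finset.sum_comm] at h2
    have h3 : ∑ _n ∈ t, δ ≤ ∑ n ∈ t, ∑ i ∈ s, ν n i :=
      Finset.sum_le_sum fun n hn => (hst n hn).trans_eq (hν n s)
    rw [Finset.sum_const, nsmul_eq_mul, mul_comm] at h3
    change _ ≤ ‖∑ n ∈ t, schreierEmb (v n)‖
    rw [← map_sum, LinearIsometry.norm_map]
    exact h3.trans h2
  intro hBS
  obtain ⟨φ, hφ, hφ0⟩ := exists_infinite_not_tendsto hδ Set.infinite_univ fun n K hKM hK => by
    obtain ⟨s, hs, h⟩ := hG.exists_subset_card_eq (isHereditaryFamily_familyG F I μ δ) n hKM hK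
    exact ⟨s, hbig hs, h⟩
  obtain ⟨ψ, hψ, y, hy⟩ := hBS (fun n => schreierEmb (v (φ n))) fun n => by
    simp only [v, map_sum, map_smul]
    exact (convex_convexHull ℝ _).sum_mem (fun i _ => hν0 _ i) (hν1 _)
      fun i _ => subset_convexHull ℝ _ ⟨i, rfl⟩
  obtain rfl := eq_zero_of_tendsto_cesaro_schreierEmb
    (fun i => (hv0 i).comp (hφ.comp hψ).tendsto_atTop) hy
  exact hφ0 ψ hψ hy

end schreier

/-! ### The family of a weakly null sequence -/

section weaklyNull

variable {𝕜 : Type*} [RCLike 𝕜] {X : Type*} [NormedAddCommGroup X] [NormedSpace 𝕜 X]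

/-- The finite sets on which some functional of the unit ball is at least `ε` in absolute value
along the sequence `x`. -/
def normingFamily (𝕜 : Type*) [RCLike 𝕜] {X : Type*} [NormedAddCommGroup X] [NormedSpace 𝕜 X]
    (x : ℕ → X) (ε : ℝ) : Set (Finset ℕ) :=
  {s | ∃ f : StrongDual 𝕜 X, ‖f‖ ≤ 1 ∧ ∀ n ∈ s, ε ≤ ‖f (x n)‖}

theorem isHereditaryFamily_normingFamily (x : ℕ → X) (ε : ℝ) :
    IsHereditaryFamily (normingFamily 𝕜 x ε) :=
  fun _ ⟨f, hf, h⟩ _ hst => ⟨f, hf, fun n hn => h n (hst hn)⟩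

/-- The family of a weakly null sequence is compact: it is the projection to `2^ℕ` of a
weak-star closed relation on the dual ball. -/
theorem isCompactFamily_normingFamily {x : ℕ → X} (hx : IsWeaklyNull 𝕜 x) {ε : ℝ} (hε : 0 < ε) :
    IsCompactFamily (normingFamily 𝕜 x ε) := by
  let B : Set (WeakDual 𝕜 X) := WeakDual.toStrongDual ⁻¹' Metric.closedBall 0 1
  let C : Set (WeakDual 𝕜 X × (ℕ → Bool)) := {p | ∀ n, p.2 n = false ∨ ε ≤ ‖p.1 (x n)‖}
  have hC : IsClosed C := by
    have : C = ⋂ n, {p : WeakDual 𝕜 X × (ℕ → Bool) | p.2 n = false} ∪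
        {p : WeakDual 𝕜 X × (ℕ → Bool) | ε ≤ ‖p.1 (x n)‖} := by
      ext p
      simp [C]
    rw [this]
    refine isClosed_iInter fun n => IsClosed.union ?_ ?_
    · exact isClosed_eq ((continuous_apply n).comp continuous_snd) continuous_const
    · exact isClosed_le continuous_const
        ((WeakDual.eval_continuous (x n)).comp continuous_fst).norm
  have hB : IsCompact B := WeakDual.isCompact_closedBall 0 1
  have hBC : IsCompact (B ×ˢ Set.univ ∩ C) := (hB.prod isCompact_univ).inter_right hC
  have heq : familyInCantor (normingFamily 𝕜 x ε) = Prod.snd '' (B ×ˢ Set.univ ∩ C) := by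
    ext a
    constructor
    · rintro ⟨s, ⟨f, hf, hs⟩, rfl⟩
      refine ⟨⟨StrongDual.toWeakDual f, _⟩, ⟨⟨?_, Set.mem_univ _⟩, fun n => ?_⟩, rfl⟩
      · exact mem_closedBall_zero_iff.2 hf
      · by_cases hn : n ∈ s
        · exact Or.inr (hs n hn)
        · exact Or.inl (decide_eq_false hn)
    · rintro ⟨⟨f, a⟩, ⟨⟨hf, -⟩, hfa⟩, rfl⟩
      -- The support is finite, since `f` tends to zero along `x`.
      have hfin : {n | a n = true}.Finite := by
        have h0 : ∀ᶠ n in Filter.atTop, ‖WeakDual.toStrongDual f (x n)‖ < ε := by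
          simpa using (hx (WeakDual.toStrongDual f)).norm.eventually_lt_const
            (u := ε) (by simpa using hε)
        rw [← Nat.cofinite_eq_atTop, Filter.eventually_cofinite] at h0
        refine h0.subset fun n hn => ?_
        rcases hfa n with h | h
        · exact absurd (hn.symm.trans h) (by simp)
        · exact not_lt.2 h
      refine ⟨hfin.toFinset, ⟨WeakDual.toStrongDual f, mem_closedBall_zero_iff.1 hf,
        fun n hn => ?_⟩, ?_⟩
      · have hn' : a n = true := by simpa using hn
        rcases hfa n with h | h
        · exact absurd (hn'.symm.trans h) (by simp)
        · exact h
      · funext n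
        simp
  rw [IsCompactFamily, heq]
  exact hBC.image continuous_snd

/-- Members of the family have a large part, a quarter by pigeonhole, over which the sum of `x` has
norm of maximal order: split according to which of `re`, `-re`, `im`, `-im` of the values of the
functional is large. -/
theorem exists_subset_mem_bigSums {x : ℕ → X} {ε : ℝ} {n : ℕ} {s : Finset ℕ}
    (hs : s ∈ normingFamily 𝕜 x ε) (hcard : s.card = 4 * n) :
    ∃ t ⊆ s, t ∈ bigSums x (ε / 2) ∧ t.card = n := by
  classical
  obtain ⟨f, hf, hfs⟩ := hs
  let L : Bool → 𝕜 →+ ℝ := fun b => if b then RCLike.re else RCLike.im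
  let σ : Bool → ℝ := fun b => if b then 1 else -1
  have hL : ∀ (p : Bool × Bool) z, σ p.2 * L p.1 z ≤ ‖z‖ := by
    rintro ⟨b, c⟩ z
    refine (le_abs_self _).trans ?_
    rw [abs_mul]
    have h1 : |σ c| = 1 := by cases c <;> simp [σ]
    rw [h1, one_mul]
    cases b
    · exact RCLike.abs_im_le_norm z
    · exact RCLike.abs_re_le_norm z
  have hex : ∀ z : 𝕜, ε ≤ ‖z‖ → ∃ p : Bool × Bool, ε / 2 ≤ σ p.2 * L p.1 z := by
    intro z hz
    by_contra! h
    have h1 : RCLike.re z < ε / 2 := by simpa [σ, L] using h (true, true)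
    have h2 : -RCLike.re z < ε / 2 := by simpa [σ, L] using h (true, false)
    have h3 : RCLike.im z < ε / 2 := by simpa [σ, L] using h (false, true)
    have h4 : -RCLike.im z < ε / 2 := by simpa [σ, L] using h (false, false)
    have h5 := RCLike.norm_sq_eq_def (z := z)
    have h6 := abs_lt.2 ⟨by linarith, h1⟩
    have h7 := abs_lt.2 ⟨by linarith, h3⟩
    rw [← abs_mul_abs_self (RCLike.re z), ← abs_mul_abs_self (RCLike.im z)] at h5
    nlinarith [abs_nonneg (RCLike.re z), abs_nonneg (RCLike.im z)]
  choose! p hp using hex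
  obtain ⟨q, -, hq⟩ := Finset.exists_le_card_fiber_of_mul_le_card_of_maps_to
    (s := s) (t := Finset.univ) (f := fun i => p (f (x i))) (n := n)
    (fun _ _ => Finset.mem_univ _) Finset.univ_nonempty (by simp [hcard])
  obtain ⟨t, ht, htn⟩ := Finset.exists_subset_card_eq hq
  refine ⟨t, ht.trans (Finset.filter_subset _ _), ?_, htn⟩
  have h1 : ∑ _i ∈ t, ε / 2 ≤ ∑ i ∈ t, σ q.2 * L q.1 (f (x i)) := by
    refine Finset.sum_le_sum fun i hi => ?_
    obtain ⟨his, hiq⟩ := Finset.mem_filter.1 (ht hi)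
    have := hp _ (hfs i his)
    rwa [hiq] at this
  rw [Finset.sum_const, nsmul_eq_mul, mul_comm, ← Finset.mul_sum, ← map_sum, ← map_sum] at h1
  refine h1.trans ((hL q _).trans ((f.le_opNorm _).trans ?_))
  exact mul_le_of_le_one_left (norm_nonneg _) hf

variable [NormedSpace ℝ X] [IsScalarTower ℝ 𝕜 X]

theorem IsWeaklyNull.eq_zero_of_tendsto_cesaro {x : ℕ → X} (hx : IsWeaklyNull 𝕜 x) {φ : ℕ → ℕ}
    (hφ : StrictMono φ) {y : X} (hy : Filter.Tendsto
      (fun n : ℕ => (n : ℝ)⁻¹ • ∑ k ∈ Finset.range n, x (φ k)) Filter.atTop (nhds y)) :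
    y = 0 := by
  refine SeparatingDual.eq_zero_of_forall_dual_eq_zero (R := 𝕜) fun f => ?_
  have h1 := ((hx f).comp hφ.tendsto_atTop).cesaro_smul
  refine tendsto_nhds_unique ((f.continuous.tendsto y).comp hy) (h1.congr fun n => ?_)
  simp only [Function.comp_apply]
  rw [ContinuousLinearMap.map_smul_of_tower, map_sum]

theorem IsWeaklyNull.not_isLargeIn_normingFamily {x : ℕ → X} (hx : IsWeaklyNull 𝕜 x)
    (hBS : IsBanachSaks (Set.range x)) {ε : ℝ} (hε : 0 < ε) {M : Set ℕ} (hM : M.Infinite) :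
    ¬ IsLargeIn (normingFamily 𝕜 x ε) M := by
  intro hlarge
  obtain ⟨φ, hφ, hφ0⟩ := exists_infinite_not_tendsto (w := x) (half_pos hε) hM
    fun n K hKM hK => by
      obtain ⟨s, hs, hsK, hcard⟩ :=
        hlarge.exists_subset_card_eq (isHereditaryFamily_normingFamily x ε) (4 * n) hKM hK
      obtain ⟨t, hts, ht, htn⟩ := exists_subset_mem_bigSums hs hcard
      exact ⟨t, ht, fun i hi => hsK (hts hi), htn⟩
  obtain ⟨ψ, hψ, y, hy⟩ := hBS (fun n => x (φ n)) fun n => ⟨_, rfl⟩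
  obtain rfl := hx.eq_zero_of_tendsto_cesaro (hφ.comp hψ) hy
  exact hφ0 ψ hψ hy

end weaklyNull

/-! ### Sequences in the convex hull -/

theorem exists_weights_of_mem_convexHull_range {X : Type*} [AddCommGroup X] [Module ℝ X]
    {x : ℕ → X} {z : X} (hz : z ∈ convexHull ℝ (Set.range x)) :
    ∃ a : ℕ → ℝ, (∀ i, 0 ≤ a i) ∧ ∃ N, (∀ i, N ≤ i → a i = 0) ∧ ∑ i ∈ Finset.range N, a i = 1 ∧
      ∑ i ∈ Finset.range N, a i • x i = z := by
  classical
  rw [convexHull_range_eq_exists_affineCombination] at hz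
  obtain ⟨s, w, hw0, hw1, rfl⟩ := hz
  rw [Finset.affineCombination_eq_linear_combination _ _ _ hw1]
  have hs : s ⊆ Finset.range (s.sup id + 1) := fun i hi =>
    Finset.mem_range.2 (Nat.lt_succ_of_le (Finset.le_sup (f := id) hi))
  refine ⟨fun i => if i ∈ s then w i else 0, fun i => ?_, s.sup id + 1, fun i hi => ?_, ?_, ?_⟩
  · dsimp only
    split_ifs with h
    exacts [hw0 i h, le_rfl]
  · exact if_neg fun h => absurd (Finset.mem_range.1 (hs h)) (not_lt.2 hi)
  · rw [Finset.sum_ite_mem, Finset.inter_eq_right.2 hs, hw1]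
  · simp_rw [ite_smul, zero_smul]
    rw [Finset.sum_ite_mem, Finset.inter_eq_right.2 hs]

/-- Gliding hump: along a subsequence the weights split into an initial part, whose sums against
`x` converge, and a part carried by the intervals `[p n, p (n + 1))`. -/
theorem exists_gliding_hump {X : Type*} [NormedAddCommGroup X] [NormedSpace ℝ X] [CompleteSpace X]
    {x : ℕ → X} (hx : ∀ i, ‖x i‖ ≤ 1) {a : ℕ → ℕ → ℝ} (ha0 : ∀ n i, 0 ≤ a n i)
    (hfin : ∀ n, ∃ N, ∀ i, N ≤ i → a n i = 0)
    (ha1 : ∀ n N, ∑ i ∈ Finset.range N, a n i ≤ 1) :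
    ∃ φ p : ℕ → ℕ, StrictMono φ ∧ StrictMono p ∧ (∀ n i, p (n + 1) ≤ i → a (φ n) i = 0) ∧
      ∃ y : X, Filter.Tendsto (fun n => ∑ i ∈ Finset.range (p n), a (φ n) i • x i)
        Filter.atTop (nhds y) := by
  have hle1 : ∀ n i, a n i ≤ 1 := fun n i =>
    (Finset.single_le_sum (fun j _ => ha0 n j) (Finset.self_mem_range_succ i)).trans (ha1 n (i + 1))
  -- Pass to a subsequence with coordinatewise convergent weights.
  obtain ⟨b, -, θ, hθ, hb⟩ := (isCompact_univ_pi fun _ : ℕ =>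
    isCompact_Icc (a := (0 : ℝ)) (b := 1)).tendsto_subseq (x := a)
      fun n i _ => ⟨ha0 n i, hle1 n i⟩
  have hbi : ∀ i, Filter.Tendsto (fun n => a (θ n) i) Filter.atTop (nhds (b i)) :=
    fun i => tendsto_pi_nhds.1 hb i
  have hb0 : ∀ i, 0 ≤ b i := fun i => ge_of_tendsto' (hbi i) fun n => ha0 _ _
  have hb1 : ∀ N, ∑ i ∈ Finset.range N, b i ≤ 1 := fun N =>
    le_of_tendsto' (tendsto_finsetSum _ fun i _ => hbi i) fun n => ha1 _ _
  have hsum : Summable fun i => b i • x i :=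
    (summable_of_sum_range_le hb0 hb1).of_norm_bounded fun i => by
      rw [norm_smul, Real.norm_of_nonneg (hb0 i)]
      exact mul_le_of_le_one_right (hb0 i) (hx i)
  have hstep : ∀ n k q : ℕ, ∃ k' q' : ℕ, k < k' ∧ q < q' ∧ (∀ i, q' ≤ i → a (θ k) i = 0) ∧
      ∑ i ∈ Finset.range q', |a (θ k') i - b i| ≤ ((n + 1 : ℕ) : ℝ)⁻¹ := by
    intro n k q
    obtain ⟨N, hN⟩ := hfin (θ k)
    have hlim : Filter.Tendsto (fun k' => ∑ i ∈ Finset.range (max N (q + 1)), |a (θ k') i - b i|)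
        Filter.atTop (nhds 0) := by
      have := tendsto_finsetSum (Finset.range (max N (q + 1))) fun i _ =>
        ((hbi i).sub_const (b i)).abs
      simpa using this
    obtain ⟨k', hk', hkk'⟩ := ((hlim.eventually_le_const
      (inv_pos.2 (Nat.cast_pos.2 n.succ_pos))).and (Filter.eventually_gt_atTop k)).exists
    exact ⟨k', max N (q + 1), hkk', (Nat.lt_succ_self q).trans_le (le_max_right _ _),
      fun i hi => hN i ((le_max_left _ _).trans hi), hk'⟩
  choose k' q' hk' hq' hsupp hclose using hstep
  let st : ℕ → ℕ × ℕ := fun n => Nat.rec (0, 0) (fun n s => (k' n s.1 s.2, q' n s.1 s.2)) n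
  have hst : ∀ n, st (n + 1) = (k' n (st n).1 (st n).2, q' n (st n).1 (st n).2) := fun _ => rfl
  have hp : StrictMono fun n => (st n).2 := strictMono_nat_of_lt_succ fun n => by
    rw [hst]
    exact hq' _ _ _
  refine ⟨fun n => θ (st n).1, fun n => (st n).2, hθ.comp (strictMono_nat_of_lt_succ fun n => ?_),
    hp, fun n i hi => ?_, ∑' i, b i • x i, ?_⟩
  · rw [hst]
    exact hk' _ _ _
  · beta_reduce at hi
    rw [hst] at hi
    exact hsupp _ _ _ i hi
  · have h1 := hsum.hasSum.tendsto_sum_nat.comp hp.tendsto_atTop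
    have h2 : ∀ n, ∑ i ∈ Finset.range (st n).2, |a (θ (st n).1) i - b i| ≤ (n : ℝ)⁻¹ := by
      rintro (_ | n)
      · simp [st]
      · rw [hst]
        exact hclose _ _ _
    have h3 : Filter.Tendsto (fun n => ∑ i ∈ Finset.range (st n).2, (a (θ (st n).1) i - b i) • x i)
        Filter.atTop (nhds 0) := by
      refine squeeze_zero_norm (fun n => ?_) (tendsto_inv_atTop_nhds_zero_nat (𝕜 := ℝ))
      refine (norm_sum_le_of_le _ fun i _ => ?_).trans (h2 n)
      rw [norm_smul, Real.norm_eq_abs]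
      exact mul_le_of_le_one_right (abs_nonneg _) (hx i)
    have h4 := h3.add h1
    rw [zero_add] at h4
    refine h4.congr fun n => ?_
    simp only [Function.comp_apply]
    rw [← Finset.sum_add_distrib]
    exact Finset.sum_congr rfl fun i _ => by rw [← add_smul, sub_add_cancel]

/-- A sequence of convex combinations without Cesàro-convergent subsequences can be replaced by
block sums, over successive intervals, without Cesàro-null subsequences. -/
theorem exists_blocks_of_not_isBanachSaks_convexHull {X : Type*} [NormedAddCommGroup X]
    [NormedSpace ℝ X] [CompleteSpace X] {x : ℕ → X} (hx : ∀ i, ‖x i‖ ≤ 1)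
    (h : ¬ IsBanachSaks (convexHull ℝ (Set.range x))) :
    ∃ (p : ℕ → ℕ) (c : ℕ → ℕ → ℝ), StrictMono p ∧ (∀ n i, 0 ≤ c n i) ∧
      (∀ n, ∑ i ∈ Finset.Ico (p n) (p (n + 1)), c n i ≤ 1) ∧
      ∀ φ : ℕ → ℕ, StrictMono φ → ¬ Filter.Tendsto (fun n : ℕ => (n : ℝ)⁻¹ •
        ∑ k ∈ Finset.range n, ∑ i ∈ Finset.Ico (p (φ k)) (p (φ k + 1)), c (φ k) i • x i)
          Filter.atTop (nhds 0) := by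
  simp only [IsBanachSaks, not_forall, not_exists, not_and] at h
  obtain ⟨z, hz, hnot⟩ := h
  choose a ha0 N hN ha1 hsum using fun n => exists_weights_of_mem_convexHull_range (hz n)
  have hext : ∀ n m, N n ≤ m → ∑ i ∈ Finset.range m, a n i • x i = z n := by
    intro n m hm
    rw [← hsum n]
    refine (Finset.sum_subset (Finset.range_mono hm) fun i _ hi => ?_).symm
    rw [hN n i (not_lt.1 fun h => hi (Finset.mem_range.2 h)), zero_smul]
  have ha1' : ∀ n m, ∑ i ∈ Finset.range m, a n i ≤ 1 := by
    intro n m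
    rw [← ha1 n, Finset.sum_subset (Finset.range_mono (le_max_left (N n) m)) fun i _ hi =>
      hN n i (not_lt.1 fun h => hi (Finset.mem_range.2 h))]
    exact Finset.sum_le_sum_of_subset_of_nonneg (Finset.range_mono (le_max_right _ _))
      fun i _ _ => ha0 n i
  obtain ⟨φ, p, hφ, hp, hsupp, y, hy⟩ :=
    exists_gliding_hump hx ha0 (fun n => ⟨N n, hN n⟩) ha1'
  refine ⟨p, fun n => a (φ n), hp, fun n => ha0 _, fun n => ?_, fun ψ hψ hnull => ?_⟩
  · refine le_trans (Finset.sum_le_sum_of_subset_of_nonneg (fun i hi => ?_) fun i _ _ => ha0 _ i)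
      (ha1' (φ n) (p (n + 1)))
    exact Finset.mem_range.2 (Finset.mem_Ico.1 hi).2
  · have hsplit : ∀ n, ∑ i ∈ Finset.range (p n), a (φ n) i • x i +
        ∑ i ∈ Finset.Ico (p n) (p (n + 1)), a (φ n) i • x i = z (φ n) := by
      intro n
      rw [Finset.sum_range_add_sum_Ico _ (hp n.lt_succ_self).le,
        ← hext (φ n) _ (le_max_right (p (n + 1)) (N (φ n)))]
      refine Finset.sum_subset (Finset.range_mono (le_max_left _ _)) fun i _ hi => ?_
      rw [hsupp n i (not_lt.1 fun h => hi (Finset.mem_range.2 h)), zero_smul]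
    refine hnot (fun n => φ (ψ n)) (hφ.comp hψ) y ?_
    have h1 := (hy.comp hψ.tendsto_atTop).cesaro_smul.add hnull
    rw [add_zero] at h1
    refine h1.congr fun n => ?_
    rw [← smul_add, ← Finset.sum_add_distrib]
    exact congrArg _ (Finset.sum_congr rfl fun k _ => hsplit _)

section largeness

variable {𝕜 : Type*} [RCLike 𝕜] {X : Type*} [NormedAddCommGroup X] [NormedSpace 𝕜 X]

/-- If a sum of `n` vectors of the unit ball has norm at least `η * n`, then some functional of the
unit ball is at least `η / 2` on at least `η / 2 * n` of them. -/
theorem exists_functional_card_le_of_le_norm_sum {w : ℕ → X} (hw : ∀ n, ‖w n‖ ≤ 1) {η : ℝ}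
    (hη : 0 ≤ η) {t : Finset ℕ} (h : η * t.card ≤ ‖∑ n ∈ t, w n‖) :
    ∃ f : StrongDual 𝕜 X, ‖f‖ ≤ 1 ∧
      η / 2 * t.card ≤ (t.filter fun n => η / 2 ≤ ‖f (w n)‖).card := by
  obtain ⟨f, hf, hfw⟩ := exists_dual_vector'' 𝕜 (∑ n ∈ t, w n)
  refine ⟨f, hf, ?_⟩
  have h1 : ‖f (∑ n ∈ t, w n)‖ ≤ ∑ n ∈ t, ((if η / 2 ≤ ‖f (w n)‖ then 1 else 0) + η / 2) := by
    rw [map_sum]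
    refine norm_sum_le_of_le _ fun n _ => ?_
    split_ifs with hn
    · linarith [(f.le_opNorm (w n)).trans (mul_le_one₀ hf (norm_nonneg _) (hw n))]
    · linarith [not_le.1 hn]
  rw [hfw, RCLike.norm_ofReal, abs_of_nonneg (norm_nonneg _), Finset.sum_add_distrib,
    Finset.sum_boole, Finset.sum_const, nsmul_eq_mul] at h1
  linarith

variable [NormedSpace ℝ X] [IsScalarTower ℝ 𝕜 X]

/-- A functional that is at least `2 * ε` on a convex combination of vectors of the unit ball is at
least `ε` on vectors of total weight at least `ε`. -/
theorem le_sum_filter_of_le_norm_apply_sum {x : ℕ → X} (hx : ∀ i, ‖x i‖ ≤ 1)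
    {f : StrongDual 𝕜 X} (hf : ‖f‖ ≤ 1) {J : Finset ℕ} {c : ℕ → ℝ} (hc0 : ∀ i, 0 ≤ c i)
    (hc1 : ∑ i ∈ J, c i ≤ 1) {ε : ℝ} (hε : 0 ≤ ε) (h : 2 * ε ≤ ‖f (∑ i ∈ J, c i • x i)‖) :
    ε ≤ ∑ i ∈ J with ε ≤ ‖f (x i)‖, c i := by
  have hfx : ∀ i, ‖f (x i)‖ ≤ 1 := fun i =>
    (f.le_opNorm _).trans (mul_le_one₀ hf (norm_nonneg _) (hx i))
  have h1 : ‖f (∑ i ∈ J, c i • x i)‖ ≤ ∑ i ∈ J, ((if ε ≤ ‖f (x i)‖ then c i else 0) + ε * c i) := by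
    rw [map_sum]
    refine norm_sum_le_of_le _ fun i _ => ?_
    rw [ContinuousLinearMap.map_smul_of_tower, norm_smul, Real.norm_of_nonneg (hc0 i)]
    have h2 := mul_nonneg hε (hc0 i)
    split_ifs with hi
    · linarith [mul_le_of_le_one_right (hc0 i) (hfx i)]
    · linarith [mul_le_mul_of_nonneg_left (not_le.1 hi).le (hc0 i)]
  rw [Finset.sum_add_distrib, ← Finset.sum_filter, ← Finset.mul_sum] at h1
  linarith [mul_le_of_le_one_right hε hc1]

/-- If the convex hull of a sequence in the unit ball is not Banach-Saks, then for some `ε` and some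
partition with measures the family `familyG` of its norming family is large: the measures are the
weights of block sums, and the members of `familyG` come from functionals norming sums of blocks. -/
theorem exists_isLargeIn_familyG_normingFamily [CompleteSpace X] {x : ℕ → X} (hx : ∀ i, ‖x i‖ ≤ 1)
    (h : ¬ IsBanachSaks (convexHull ℝ (Set.range x))) :
    ∃ ε > 0, ∃ (I : ℕ → Finset ℕ) (μ : ∀ n, MeasureTheory.ProbabilityMeasure (I n)),
      (∀ m n, m ≠ n → Disjoint (I m) (I n)) ∧ (⋃ n, (I n : Set ℕ)) = Set.univ ∧
      IsLargeIn (familyG (normingFamily 𝕜 x ε) I μ ε) Set.univ := by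
  classical
  obtain ⟨p, c, hp, hc0, hc1, hnull⟩ := exists_blocks_of_not_isBanachSaks_convexHull hx h
  let w : ℕ → X := fun n => ∑ i ∈ Finset.Ico (p n) (p (n + 1)), c n i • x i
  have hw : ∀ n, ‖w n‖ ≤ 1 := fun n => by
    refine (norm_sum_le_of_le _ fun i _ => ?_).trans (hc1 n)
    rw [norm_smul, Real.norm_of_nonneg (hc0 n i)]
    exact mul_le_of_le_one_right (hc0 n i) (hx i)
  obtain ⟨η, hη, M, hM, hbig⟩ := exists_bigSums_of_not_tendsto hw hnull
  have : Infinite M := hM.to_subtype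
  let m := Nat.orderEmbeddingOfSet M
  have hmM : ∀ n, m n ∈ M := fun n => by
    have := Set.mem_range_self (f := m) n
    rwa [Nat.orderEmbeddingOfSet_range] at this
  -- The `n`-th interval starts where the block of index `m n` does, except for the first one,
  -- which starts at `0` for the intervals to cover `ℕ`.
  let P : ℕ → ℕ := fun n => if n = 0 then 0 else p (m n)
  have hPp : ∀ n, P n ≤ p (m n) := fun n => by
    dsimp only [P]
    split_ifs <;> simp
  have hP : StrictMono P := strictMono_nat_of_lt_succ fun n =>
    (hPp n).trans_lt (hp (m.strictMono n.lt_succ_self))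
  let J : ℕ → Finset ℕ := fun n => Finset.Ico (p (m n)) (p (m n + 1))
  let I : ℕ → Finset ℕ := fun n => Finset.Ico (P n) (P (n + 1))
  have hJI : ∀ n, J n ⊆ I n := fun n =>
    Finset.Ico_subset_Ico (hPp n) (hp.monotone (m.strictMono n.lt_succ_self))
  have hμ : ∀ n, ∃ μ : MeasureTheory.ProbabilityMeasure (I n),
      ∀ s ⊆ I n, ∑ i ∈ s, (if i ∈ J n then c (m n) i else 0) ≤ (μ {i : I n | (i : ℕ) ∈ s} : ℝ) := by
    intro n
    refine exists_probabilityMeasure_of_weights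
      (Finset.nonempty_Ico.2 (hP n.lt_succ_self)) (fun i => ?_) ?_
    · split_ifs
      exacts [hc0 _ i, le_rfl]
    · rw [Finset.sum_ite_mem, Finset.inter_eq_right.2 (hJI n)]
      exact hc1 _
  choose μ hμ using hμ
  refine ⟨η / 4, by positivity, I, μ, fun a b hab => ?_, ?_, fun n K _ hK => ?_⟩
  · rw [← Finset.disjoint_coe, Finset.coe_Ico, Finset.coe_Ico]
    exact hP.monotone.pairwise_disjoint_on_Ico_succ hab
  · have := iUnion_Ico_map_succ_eq_Ici (f := P) (fun n => hP.monotone bot_le)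
      hP.not_bddAbove_range_of_isSuccArchimedean
    simpa [I, P] using this
  · obtain ⟨N, hN⟩ := exists_nat_ge (n / (η / 2))
    obtain ⟨s, hs, hsK, hsN⟩ := hbig N (m '' K) (by rintro _ ⟨k, -, rfl⟩; exact hmM k)
      (hK.image m.injective.injOn)
    obtain ⟨t, htK, rfl⟩ := Finset.subset_set_image_iff.1 hsK
    rw [Finset.card_image_of_injective _ m.injective] at hsN
    simp only [bigSums, Set.mem_ofPred_eq] at hs
    rw [Finset.card_image_of_injective _ m.injective, Finset.sum_image m.injective.injOn] at hs
    obtain ⟨f, hf, hcard⟩ := exists_functional_card_le_of_le_norm_sum (𝕜 := 𝕜)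
      (w := fun k => w (m k)) (fun k => hw _) hη.le hs
    let r := t.filter fun k => η / 2 ≤ ‖f (w (m k))‖
    refine ⟨r, ⟨r.biUnion fun k => (J k).filter fun i => η / 4 ≤ ‖f (x i)‖,
      ⟨f, hf, fun i hi => ?_⟩, fun k hk => ?_⟩, ?_⟩
    · obtain ⟨k, -, hi⟩ := Finset.mem_biUnion.1 hi
      exact (Finset.mem_filter.1 hi).2
    · have h1 := le_sum_filter_of_le_norm_apply_sum hx hf (hc0 (m k)) (hc1 (m k))
        (ε := η / 4) (by positivity) (by
          have := (Finset.mem_filter.1 hk).2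
          linarith)
      have h2 := hμ k ((J k).filter fun i => η / 4 ≤ ‖f (x i)‖)
        ((Finset.filter_subset _ _).trans (hJI k))
      rw [Finset.sum_ite_mem, Finset.inter_eq_left.2 (Finset.filter_subset _ _)] at h2
      refine h1.trans (h2.trans ?_)
      refine NNReal.coe_le_coe.2 ((μ k).apply_mono fun i hi => ?_)
      exact Finset.mem_biUnion.2 ⟨k, hk, hi⟩
    · have hrK : (r : Set ℕ) ∩ K = r := Set.inter_eq_left.2 fun k hk =>
        htK (Finset.mem_filter.1 hk).1
      rw [hrK, Set.ncard_coe_finset]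
      rw [hsN] at hcard
      have := (div_le_iff₀ (half_pos hη)).1 hN
      have h3 : (n : ℝ) ≤ r.card := by linarith
      exact_mod_cast h3

end largeness

/-! ### The equivalence -/

theorem IsBanachSaks.of_image {X Y : Type*} [NormedAddCommGroup X] [NormedSpace ℝ X]
    [NormedAddCommGroup Y] [NormedSpace ℝ Y] (e : X ≃ₗᵢ[ℝ] Y) {A : Set X}
    (h : IsBanachSaks (e '' A)) : IsBanachSaks A := by
  intro x hx
  obtain ⟨φ, hφ, y, hy⟩ := h (fun n => e (x n)) fun n => ⟨_, hx n, rfl⟩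
  refine ⟨φ, hφ, e.symm y, ((e.symm.continuous.tendsto y).comp hy).congr fun n => ?_⟩
  simp [map_sum]
theorem mainTheorem3 (𝕜 : Type) [RCLike 𝕜] :
    List.TFAE [
      -- (a)
      ∃ (X : Type u) (_ : NormedAddCommGroup X) (_ : NormedSpace 𝕜 X) (_ : NormedSpace ℝ X)
        (_ : IsScalarTower ℝ 𝕜 X) (_ : CompleteSpace X) (x : ℕ → X),
        (∀ n, ‖x n‖ = 1) ∧ IsWeaklyNull 𝕜 x ∧ IsBanachSaks (Set.range x) ∧
          ¬ IsBanachSaks (convexHull ℝ (Set.range x)),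
      -- (b)
      ∃ F : Set (Finset ℕ), IsPrecompactFamily F ∧
        IsBanachSaks (Set.range (schreierUnit 𝕜 F)) ∧
        ¬ IsBanachSaks (convexHull ℝ (Set.range (schreierUnit 𝕜 F))),
      -- (c)
      ∃ F : Set (Finset ℕ), IsCompactFamily F ∧ IsHereditaryFamily F ∧
        (∀ M : Set ℕ, M.Infinite → ¬ IsLargeIn F M) ∧
        ∃ (I : ℕ → Finset ℕ) (μ : ∀ n, MeasureTheory.ProbabilityMeasure (I n)) (δ : ℝ),
          (∀ m n, m ≠ n → Disjoint (I m) (I n)) ∧ (⋃ n, (I n : Set ℕ)) = Set.univ ∧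
          0 < δ ∧ IsLargeIn (familyG F I μ δ) Set.univ] := by
  tfae_have 3 → 2 := by
    rintro ⟨F, hF, -, hlarge, I, μ, δ, hI, -, hδ, hG⟩
    exact ⟨F, hF.isPrecompactFamily, isBanachSaks_range_schreierUnit hlarge,
      not_isBanachSaks_convexHull_range_schreierUnit hI hδ hG⟩
  tfae_have 2 → 1 := by
    rintro ⟨F, -, hBS, hconv⟩
    let e : ULift.{u} (SchreierSpace 𝕜 F) ≃ₗᵢ[ℝ] SchreierSpace 𝕜 F := LinearIsometryEquiv.ulift ℝ _
    have he : (fun z => e.symm z) '' Set.range (schreierUnit 𝕜 F) =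
        Set.range fun n => e.symm (schreierUnit 𝕜 F n) := by
      rw [← Set.range_comp]
      rfl
    refine ⟨ULift.{u} (SchreierSpace 𝕜 F), inferInstance, inferInstance, inferInstance,
      inferInstance, inferInstance, fun n => e.symm (schreierUnit 𝕜 F n), fun n => ?_,
      fun f => ?_, ?_, fun h => hconv ?_⟩
    · rw [LinearIsometryEquiv.norm_map, norm_schreierUnit]
    · exact isWeaklyNull_schreierUnit hBS
        (f.comp (LinearIsometryEquiv.ulift 𝕜
          (SchreierSpace 𝕜 F)).symm.toContinuousLinearEquiv.toContinuousLinearMap)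
    · refine IsBanachSaks.of_image e ?_
      rw [← Set.range_comp]
      simpa [Function.comp_def] using hBS
    · refine IsBanachSaks.of_image e.symm ?_
      have h1 := e.symm.toLinearEquiv.toLinearMap.image_convexHull (Set.range (schreierUnit 𝕜 F))
      rw [← he] at h
      exact h1 ▸ h
  tfae_have 1 → 3 := by
    rintro ⟨X, _, _, _, _, _, x, hx1, hx, hBS, hconv⟩
    obtain ⟨ε, hε, I, μ, hI, hU, hG⟩ :=
      exists_isLargeIn_familyG_normingFamily (𝕜 := 𝕜) (fun i => (hx1 i).le) hconv
    exact ⟨normingFamily 𝕜 x ε, isCompactFamily_normingFamily hx hε,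
      isHereditaryFamily_normingFamily x ε, fun M hM => hx.not_isLargeIn_normingFamily hBS hε hM,
      I, μ, ε, hI, hU, hε, hG⟩
  tfae_finish
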